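/- Let $X$ be a finite set (the alphabet), $X^*$ the rooted tree of finite words over $X$, and $\mathrm{Aut}(X^*)$ the group of bijections of $X^*$ that preserve lengths and prefixes of words. For $g\in\mathrm{Aut}(X^*)$ and $v\in X^*$ let $g|_v\in\mathrm{Aut}(X^*)$ be the automorphism with $g(vw)=g(v)\,g|_v(w)$ for all $w\in X^*$. An automorphism $g$ is *bounded* if it is defined by a state of a finite automaton (equivalently, $\{g|_v : v\in X^*\}$ is finite) and the sequence $\theta(k,g)=\#\{v\in X^k : g|_v \text{ acts non-trivially on } X^1\}$, $k\ge 0$, is bounded. Let $\mathcal B$ be the set of all bounded automorphisms of $X^*$. A subgroup $G\le\mathrm{Aut}(X^*)$ is *self-similar* if for all $g\in G$, $x\in X$ there are $h\in G$, $y\in X$ with $g(xw)=y\,h(w)$ for all $w\in X^*$. A self-similar group $G$ is *contracting* if there is a finite set $\mathcal N\subset G$ with $g|_x\in\mathcal N$ for all $g\in\mathcal N$, $x\in X$, such that for every $g\in G$ there is $n\in\mathbb N$ with $g|_v\in\mathcal N$ for all words $v$ of length at least $n$. Let $X^{-\omega}$ be the space of left-infinite sequences $\ldots x_2x_1$ over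 $X$. Two sequences $\ldots x_2x_1$ and $\ldots y_2y_1$ are *asymptotically equivalent* if there is a sequence $(g_k)_{k\ge1}$ in $G$ taking only finitely many values with $g_k(x_k\ldots x_1)=y_k\ldots y_1$ for all $k$. The *limit space* of $G$ is the quotient of $X^{-\omega}$ by this equivalence relation, and for $v\in X^*$ the *tile* $\mathscr T_v$ is the image in it of the set $X^{-\omega}v$ of sequences ending in $v$. The group $G$ *has a post-critically finite (p.c.f.) limit space* if $G$ is contracting and $\mathscr T_u\cap\mathscr T_v$ is finite for any two different words $u,v$ of the same length. **Theorem.** (1) The set $\mathcal B$ is a group (a subgroup of $\mathrm{Aut}(X^*)$). (2) A finitely generated self-similar group $G\le\mathrm{Aut}(X^*)$ has a p.c.f. limit space if and only if $G\subseteq\mathcal B$. (3) In particular, every finitely generated self-similar subgroup of $\mathcal B$ is contracting. -/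

import Mathlib

namespace SelfSimilarGroup

/-! ### Automorphisms of the rooted tree of finite words

The vertices of the tree are the finite words `List X`; the root is the empty word, and a word `v`
lies above its continuations. An automorphism is a bijection preserving levels and prefixes. -/

/-- The automorphism group of the rooted tree `X*`. -/
def treeAut (X : Type*) : Subgroup (Equiv.Perm (List X)) where
  carrier := {g | (∀ v, (g v).length = v.length) ∧ ∀ v w, v <+: w → g v <+: g w}
  one_mem' := ⟨fun _ => rfl, fun _ _ h => h⟩
  mul_mem' := by
    rintro a b ⟨ha, ha'⟩ ⟨hb, hb'⟩
    exact ⟨fun v => by simp [ha, hb], fun v w h => ha' _ _ (hb' _ _ h)⟩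
  inv_mem' := by
    rintro g ⟨hl, hp⟩
    have hi : ∀ v, g (g⁻¹ v) = v := Equiv.apply_symm_apply g
    have hl' : ∀ v, (g⁻¹ v).length = v.length := fun v => by
      have h := hl (g⁻¹ v)
      rw [hi] at h
      exact h.symm
    refine ⟨hl', fun v w h => ?_⟩
    have h1 : g ((g⁻¹ w).take v.length) <+: w := by
      have h2 := hp _ _ (List.take_prefix v.length (g⁻¹ w))
      rwa [hi] at h2
    have h3 : (g ((g⁻¹ w).take v.length)).length = v.length := by
      rw [hl, List.length_take, hl']
      exact min_eq_left h.length_le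
    have h4 : g ((g⁻¹ w).take v.length) = v :=
      (List.prefix_of_prefix_length_le h1 h h3.le).eq_of_length h3
    have h5 : g⁻¹ v = (g⁻¹ w).take v.length := by
      rw [Equiv.Perm.inv_eq_iff_eq, h4]
    rw [h5]
    exact List.take_prefix _ _

variable {X : Type*}

theorem apply_append (g : treeAut X) (v w : List X) :
    g.1 (v ++ w) = g.1 v ++ (g.1 (v ++ w)).drop v.length := by
  obtain ⟨t, ht⟩ := g.2.2 v (v ++ w) (List.prefix_append v w)
  rw [← ht, ← g.2.1 v, List.drop_left]

theorem length_drop_apply_append (g : treeAut X) (v w : List X) :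
    ((g.1 (v ++ w)).drop v.length).length = w.length := by
  simp [g.2.1]

/-- The restriction `g|_v`: the automorphism with `g(vw) = g(v) g|_v(w)` for all words `w`. -/
def restrict (g : treeAut X) (v : List X) : treeAut X :=
  ⟨{ toFun := fun w => (g.1 (v ++ w)).drop v.length
     invFun := fun w => (g⁻¹.1 (g.1 v ++ w)).drop (g.1 v).length
     left_inv := fun w => by
      have h : g⁻¹.1 (g.1 v ++ (g.1 (v ++ w)).drop v.length) = v ++ w := by
        rw [← apply_append]
        exact Equiv.symm_apply_apply g.1 (v ++ w)
      change (g⁻¹.1 (g.1 v ++ (g.1 (v ++ w)).drop v.length)).drop (g.1 v).length = w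
      rw [h, g.2.1, List.drop_left]
     right_inv := fun w => by
      have h := apply_append g⁻¹ (g.1 v) w
      have hv : g⁻¹.1 (g.1 v) = v := Equiv.symm_apply_apply g.1 v
      rw [hv] at h
      change (g.1 (v ++ (g⁻¹.1 (g.1 v ++ w)).drop (g.1 v).length)).drop v.length = w
      rw [← h]
      have h2 : g.1 (g⁻¹.1 (g.1 v ++ w)) = g.1 v ++ w := Equiv.apply_symm_apply g.1 _
      rw [h2, ← g.2.1 v, List.drop_left] },
    fun w => length_drop_apply_append g v w,
    fun u w h => by
      have h1 := g.2.2 _ _ ((List.prefix_append_right_inj v).2 h)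
      exact h1.drop v.length⟩

theorem apply_append_eq (g : treeAut X) (v w : List X) :
    g.1 (v ++ w) = g.1 v ++ (restrict g v).1 w :=
  apply_append g v w

/-- The letter `g(x)`, for a letter `x`: the one-letter word `[x]` is sent to `[g(x)]`. -/
def letterMap (g : treeAut X) (x : X) : X :=
  (g.1 [x]).head (List.ne_nil_of_length_pos (by simp [g.2.1]))

theorem apply_singleton (g : treeAut X) (x : X) : g.1 [x] = [letterMap g x] := by
  have h : (g.1 [x]).length = 1 := g.2.1 [x]
  obtain ⟨y, hy⟩ := List.length_eq_one_iff.1 h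
  simp [letterMap, hy]

theorem apply_cons (g : treeAut X) (x : X) (w : List X) :
    g.1 (x :: w) = letterMap g x :: (restrict g [x]).1 w := by
  have h := apply_append_eq g [x] w
  rw [apply_singleton] at h
  exact h

/-! ### Automata -/

/-- An automaton with set of states `Q` over the alphabet `X`: `trans q x` is `q|_x` and `out q x`
is `q(x)`. -/
structure Automaton (Q X : Type*) where
  /-- the transition function -/
  trans : Q → X → Q
  /-- the output function -/
  out : Q → X → X

namespace Automaton

variable {Q : Type*}

/-- The extended transition function, `q|_v`. -/
def transWord (A : Automaton Q X) : Q → List X → Q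
  | q, [] => q
  | q, x :: v => A.transWord (A.trans q x) v

/-- The extended output function, `q(v)`: the action of the state `q` on words. -/
def act (A : Automaton Q X) : Q → List X → List X
  | _, [] => []
  | q, x :: v => A.out q x :: A.act (A.trans q x) v

/-- A set of states is a sub-automaton if it is closed under the transitions. -/
def IsSubautomaton (A : Automaton Q X) (N : Set Q) : Prop :=
  ∀ q ∈ N, ∀ x, A.trans q x ∈ N

/-- There is a finite sub-automaton which absorbs every state after finitely many steps. -/
def HasFiniteNucleus (A : Automaton Q X) : Prop :=
  ∃ N : Set Q, N.Finite ∧ A.IsSubautomaton N ∧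
    ∀ q, ∃ n : ℕ, ∀ v : List X, n ≤ v.length → A.transWord q v ∈ N

end Automaton

/-! ### Self-similar and contracting groups -/

/-- A group `G` of automorphisms of `X*` is self-similar if for all `g ∈ G` and `x ∈ X` there are
`h ∈ G` and `y ∈ X` with `g(xw) = y h(w)` for all words `w`. -/
def IsSelfSimilar (G : Subgroup (treeAut X)) : Prop :=
  ∀ g ∈ G, ∀ x : X, ∃ h ∈ G, ∃ y : X, ∀ w : List X, g.1 (x :: w) = y :: h.1 w

theorem IsSelfSimilar.restrict_mem {G : Subgroup (treeAut X)} (hG : IsSelfSimilar G)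
    {g : treeAut X} (hg : g ∈ G) (x : X) : restrict g [x] ∈ G := by
  obtain ⟨h, hh, y, hy⟩ := hG g hg x
  have : restrict g [x] = h := by
    refine Subtype.ext (Equiv.ext fun w => ?_)
    have h1 := hy w
    rw [apply_cons] at h1
    exact (List.cons.inj h1).2
  rwa [this]

/-- The complete automaton of a self-similar group: the states are the elements of the group. -/
def completeAutomaton (G : Subgroup (treeAut X)) (hG : IsSelfSimilar G) : Automaton G X where
  trans g x := ⟨restrict g.1 [x], hG.restrict_mem g.2 x⟩
  out g x := letterMap g.1 x

theorem completeAutomaton_act (G : Subgroup (treeAut X)) (hG : IsSelfSimilar G) (g : G)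
    (v : List X) : (completeAutomaton G hG).act g v = g.1.1 v := by
  induction v generalizing g with
  | nil => exact (List.eq_nil_of_length_eq_zero (g.1.2.1 [])).symm
  | cons x v ih =>
    rw [apply_cons]
    change letterMap g.1 x :: _ = _
    rw [ih]
    rfl

/-- A self-similar group is contracting if its complete automaton has a finite nucleus. -/
def IsContracting (G : Subgroup (treeAut X)) : Prop :=
  ∃ hG : IsSelfSimilar G, (completeAutomaton G hG).HasFiniteNucleus

/-! ### Limit spaces and tiles

A left-infinite sequence `… x₂ x₁` is a function `x : ℕ → X`, the letter `x_{k+1}` being `x k`. -/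

/-- The word `x_k … x₁` at the end of the left-infinite sequence `… x₂ x₁`. -/
def endWord (x : ℕ → X) : ℕ → List X
  | 0 => []
  | k + 1 => x k :: endWord x k

/-- Asymptotic equivalence: some sequence of elements of `G` with finitely many values satisfies
`g_k(x_k … x₁) = y_k … y₁` for all `k`. -/
def AsympEquiv (G : Subgroup (treeAut X)) (x y : ℕ → X) : Prop :=
  ∃ g : ℕ → G, (Set.range g).Finite ∧ ∀ k, (g k).1.1 (endWord x k) = endWord y k

/-- Asymptotic equivalence is an equivalence relation. -/
def asympSetoid (G : Subgroup (treeAut X)) : Setoid (ℕ → X) where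
  r := AsympEquiv G
  iseqv :=
    { refl := fun x => ⟨fun _ => 1, Set.toFinite _ |>.subset Set.range_const_subset, fun _ => rfl⟩
      symm := by
        rintro x y ⟨g, hg, h⟩
        refine ⟨fun k => (g k)⁻¹, ?_, fun k => ?_⟩
        · refine (hg.image (fun a => a⁻¹)).subset ?_
          rintro _ ⟨k, rfl⟩
          exact ⟨g k, ⟨k, rfl⟩, rfl⟩
        · rw [← h k]
          exact Equiv.symm_apply_apply (g k).1.1 _
      trans := by
        rintro x y z ⟨g, hg, h⟩ ⟨g', hg', h'⟩
        refine ⟨fun k => g' k * g k, ?_, fun k => ?_⟩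
        · refine (Set.Finite.image2 (fun a b => a * b) hg' hg).subset ?_
          rintro _ ⟨k, rfl⟩
          exact ⟨g' k, ⟨k, rfl⟩, g k, ⟨k, rfl⟩, rfl⟩
        · rw [← h' k, ← h k]
          rfl }

/-- The limit space of `G`: left-infinite sequences modulo asymptotic equivalence. -/
def LimitSpace (G : Subgroup (treeAut X)) : Type _ :=
  Quotient (asympSetoid G)

/-- The point of the limit space represented by a left-infinite sequence. -/
def LimitSpace.mk (G : Subgroup (treeAut X)) (x : ℕ → X) : LimitSpace G :=
  Quotient.mk (asympSetoid G) x

/-- The quotient of the product topology, the alphabet being discrete. -/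
instance (G : Subgroup (treeAut X)) : TopologicalSpace (LimitSpace G) :=
  TopologicalSpace.coinduced (LimitSpace.mk G) (@Pi.topologicalSpace ℕ (fun _ => X) fun _ => ⊥)

/-- The tile of the word `v`: the image of the set of left-infinite sequences ending in `v`. -/
def tile (G : Subgroup (treeAut X)) (v : List X) : Set (LimitSpace G) :=
  LimitSpace.mk G '' {x | endWord x v.length = v}

/-- `G` has a post-critically finite limit space: `G` is (self-similar and) contracting, and two
tiles of the same level with different indices intersect in a finite set. -/
def HasPCFLimitSpace (G : Subgroup (treeAut X)) : Prop :=
  IsContracting G ∧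
    ∀ u v : List X, u.length = v.length → u ≠ v → (tile G u ∩ tile G v).Finite

/-! ### Bounded automorphisms -/

/-- `g` is defined by a state of a finite automaton. -/
def IsFiniteAutomatic (g : treeAut X) : Prop :=
  ∃ (Q : Type) (_ : Finite Q) (A : Automaton Q X) (q : Q), ∀ v, g.1 v = A.act q v

/-- The number of words `v` of length `k` such that `g|_v` acts non-trivially on the first level. -/
noncomputable def activity (k : ℕ) (g : treeAut X) : ℕ :=
  Set.ncard {v : List X | v.length = k ∧ ∃ x : X, (restrict g v).1 [x] ≠ [x]}

/-- The set of bounded automorphisms: those defined by finite automata and of bounded activity. -/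
def boundedAut (X : Type*) : Set (treeAut X) :=
  {g | IsFiniteAutomatic g ∧ ∃ C : ℕ, ∀ k, activity k g ≤ C}

end SelfSimilarGroup

namespace SelfSimilarGroup

variable {X : Type*}

/-! ### Restrictions -/

/-! For a finite-state `g`, bounded activity is equivalent to a bound on the number of words `v` of
each length with `g|_v ≠ 1` (`mem_boundedAut_iff`). In this form closure under products and inverses
follows from `(gh)|_v = g|_{h(v)} h|_v`.

Contraction. From some level on, each non-finitary restriction of a bounded `g` has exactly one
non-finitary restriction on every deeper level, and these eventually repeat periodically. If `n` is
a large factorial, divisible by all the periods, the restrictions of `g` on level `n` are therefore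
atoms: finitary of depth `n`, or circuits of length `n`. Restricting a product of two atoms on level
`2n` gives an atom again, so one `n` that serves all generators serves the whole group. There are
finitely many atoms, since an atom is determined by its action on level `n` and its restrictions
there; the restrictions of atoms that lie in `G` form a nucleus.

Tiles. Equivalent sequences ending in different words `u`, `v` are matched on long ends `wu` by
nucleus elements `g` with `g|_w(u) = v`, hence `g|_w ≠ 1`. Boundedness limits the choices of `w`, so
only finitely many sequences occur. Conversely, after shrinking the nucleus so that every element is
a restriction of another, each word `w` with `h|_w ≠ 1` extends to a left-infinite sequence
equivalent to one with a different end of fixed length `d`. Finite tile intersections allow finitely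
many of these, which bounds the number of `w` (`ncard_support_le_of_essential`). -/

theorem treeAut_ext {g h : treeAut X} (H : ∀ w, g.1 w = h.1 w) : g = h :=
  Subtype.ext (Equiv.ext H)

theorem length_apply (g : treeAut X) (v : List X) : (g.1 v).length = v.length := g.2.1 v

theorem apply_nil (g : treeAut X) : g.1 [] = [] :=
  List.eq_nil_of_length_eq_zero (length_apply g [])

theorem mul_apply (g h : treeAut X) (v : List X) : (g * h).1 v = g.1 (h.1 v) := rfl

theorem one_apply (v : List X) : (1 : treeAut X).1 v = v := rfl

theorem apply_inv_apply (g : treeAut X) (v : List X) : g.1 (g⁻¹.1 v) = v :=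
  Equiv.apply_symm_apply g.1 v

theorem inv_apply_apply (g : treeAut X) (v : List X) : g⁻¹.1 (g.1 v) = v :=
  Equiv.symm_apply_apply g.1 v

theorem apply_eq_of_apply_append_eq {g : treeAut X} {v w v' w' : List X}
    (h : g.1 (v ++ w) = v' ++ w') (hl : v.length = v'.length) :
    g.1 v = v' ∧ (restrict g v).1 w = w' := by
  rw [apply_append_eq] at h
  exact List.append_inj h (by rw [length_apply, hl])

theorem eq_restrict {g h : treeAut X} {v : List X}
    (H : ∀ w, g.1 (v ++ w) = g.1 v ++ h.1 w) : restrict g v = h :=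
  treeAut_ext fun w => (apply_eq_of_apply_append_eq (H w) (length_apply g v).symm).2

theorem restrict_nil (g : treeAut X) : restrict g [] = g :=
  eq_restrict fun w => by rw [apply_nil]; rfl

theorem restrict_append (g : treeAut X) (v w : List X) :
    restrict g (v ++ w) = restrict (restrict g v) w :=
  eq_restrict fun u => by
    rw [List.append_assoc, apply_append_eq g v, apply_append_eq g v, apply_append_eq _ w,
      List.append_assoc]

theorem restrict_cons (g : treeAut X) (x : X) (w : List X) :
    restrict g (x :: w) = restrict (restrict g [x]) w :=
  restrict_append g [x] w

theorem restrict_one (v : List X) : restrict (1 : treeAut X) v = 1 :=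
  eq_restrict fun _ => rfl

theorem restrict_mul (g h : treeAut X) (v : List X) :
    restrict (g * h) v = restrict g (h.1 v) * restrict h v :=
  eq_restrict fun w => by
    rw [mul_apply, mul_apply, mul_apply, apply_append_eq h, apply_append_eq g]

theorem restrict_inv (g : treeAut X) (v : List X) :
    restrict g⁻¹ v = (restrict g (g⁻¹.1 v))⁻¹ := by
  rw [eq_inv_iff_mul_eq_one, ← restrict_one (g⁻¹.1 v), ← inv_mul_cancel g, restrict_mul,
    apply_inv_apply]

theorem exists_restrict_apply_singleton_ne {g : treeAut X} (hg : g ≠ 1) :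
    ∃ (w : List X) (x : X), (restrict g w).1 [x] ≠ [x] := by
  by_contra! H
  refine hg (treeAut_ext fun v => ?_)
  rw [one_apply]
  induction v generalizing g with
  | nil => exact apply_nil g
  | cons x v ih =>
    by_cases h1 : restrict g [x] = 1
    · have := H [] x
      rw [restrict_nil] at this
      rw [← List.singleton_append, apply_append_eq, this, h1, one_apply]
    · have := H [] x
      rw [restrict_nil] at this
      rw [← List.singleton_append, apply_append_eq, this,
        ih h1 fun w y => by rw [← restrict_append]; exact H _ y]

/-! ### Finite-state automorphisms -/

/-- `g` has finitely many restrictions. -/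
def IsFiniteState (g : treeAut X) : Prop :=
  (Set.range (restrict g)).Finite

theorem Automaton.act_append {Q : Type*} (A : Automaton Q X) (q : Q) (v w : List X) :
    A.act q (v ++ w) = A.act q v ++ A.act (A.transWord q v) w := by
  induction v generalizing q with
  | nil => rfl
  | cons x v ih => simp [Automaton.act, Automaton.transWord, ih]

theorem Automaton.length_act {Q : Type*} (A : Automaton Q X) (q : Q) (v : List X) :
    (A.act q v).length = v.length := by
  induction v generalizing q with
  | nil => rfl
  | cons x v ih => simp [Automaton.act, ih]

theorem isFiniteAutomatic_iff (g : treeAut X) : IsFiniteAutomatic g ↔ IsFiniteState g := by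
  constructor
  · rintro ⟨Q, _, A, q, h⟩
    have key : ∀ v w, (restrict g v).1 w = A.act (A.transWord q v) w := fun v w => by
      refine (apply_eq_of_apply_append_eq ((h (v ++ w)).trans (A.act_append q v w)) ?_).2
      rw [A.length_act]
    classical
    -- The state reached along `v` determines `g|_v`, so the restrictions are indexed by states;
    -- unreachable states get the value 1.
    let F : Q → treeAut X := fun r =>
      if hr : ∃ v, A.transWord q v = r then restrict g hr.choose else 1
    refine (Set.finite_range F).subset ?_
    rintro _ ⟨v, rfl⟩
    refine ⟨A.transWord q v, ?_⟩
    have hr : ∃ w, A.transWord q w = A.transWord q v := ⟨v, rfl⟩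
    have : F (A.transWord q v) = restrict g hr.choose := dif_pos hr
    rw [this]
    exact treeAut_ext fun w => by rw [key, key, hr.choose_spec]
  · intro h
    have := h.to_subtype
    -- The restrictions themselves are the states; they are renamed by `Fin n` because the automaton
    -- must have its states in `Type`, while `X` lives in any universe.
    obtain ⟨n, ⟨e⟩⟩ := Finite.exists_equiv_fin (Set.range (restrict g))
    let step : Set.range (restrict g) → X → Set.range (restrict g) := fun r x =>
      ⟨restrict r.1 [x], by
        obtain ⟨v, hv⟩ := r.2
        exact ⟨v ++ [x], by rw [restrict_append, hv]⟩⟩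
    let A : Automaton (Fin n) X :=
      ⟨fun i x => e (step (e.symm i) x), fun i x => letterMap (e.symm i).1 x⟩
    have key : ∀ (v : List X) (i : Fin n), A.act i v = (e.symm i).1.1 v := by
      intro v
      induction v with
      | nil => exact fun i => (apply_nil _).symm
      | cons x v ih =>
        intro i
        rw [apply_cons]
        change letterMap (e.symm i).1 x :: A.act (e (step (e.symm i) x)) v = _
        rw [ih, Equiv.symm_apply_apply]
    refine ⟨Fin n, inferInstance, A, e ⟨g, ⟨[], restrict_nil g⟩⟩, fun v => ?_⟩
    rw [key, Equiv.symm_apply_apply]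

theorem IsFiniteState.mul {g h : treeAut X} (hg : IsFiniteState g) (hh : IsFiniteState h) :
    IsFiniteState (g * h) := by
  refine (Set.Finite.image2 (fun a b => a * b) hg hh).subset ?_
  rintro _ ⟨v, rfl⟩
  exact ⟨_, ⟨h.1 v, rfl⟩, _, ⟨v, rfl⟩, (restrict_mul g h v).symm⟩

theorem IsFiniteState.inv {g : treeAut X} (hg : IsFiniteState g) : IsFiniteState g⁻¹ := by
  refine (hg.image fun a => a⁻¹).subset ?_
  rintro _ ⟨v, rfl⟩
  exact ⟨_, ⟨g⁻¹.1 v, rfl⟩, (restrict_inv g v).symm⟩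

theorem IsFiniteState.one : IsFiniteState (1 : treeAut X) := by
  refine (Set.finite_singleton 1).subset ?_
  rintro _ ⟨v, rfl⟩
  exact restrict_one v

/-! ### Words with nontrivial restriction -/

/-- The words `v` of length `k` with `g|_v ≠ 1`. -/
def support (g : treeAut X) (k : ℕ) : Set (List X) :=
  {v | v.length = k ∧ restrict g v ≠ 1}

theorem exists_ncard_biUnion_le {ι κ α : Type*} {T : Set ι} (hT : T.Finite) (s : ι → κ → Set α)
    (h : ∀ t ∈ T, ∃ C : ℕ, ∀ k, (s t k).ncard ≤ C) :
    ∃ C : ℕ, ∀ k, (⋃ t ∈ T, s t k).ncard ≤ C := by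
  choose! C hC using h
  refine ⟨∑ t ∈ hT.toFinset, C t, fun k => ?_⟩
  have h1 := hT.toFinset.set_ncard_biUnion_le fun t => s t k
  simp only [Set.Finite.mem_toFinset] at h1
  exact h1.trans (Finset.sum_le_sum fun t ht => hC t (hT.mem_toFinset.1 ht) k)

variable [Finite X]

theorem finite_support (g : treeAut X) (k : ℕ) : (support g k).Finite :=
  (List.finite_length_eq X k).subset fun _ h => h.1

/-- Each of the finitely many nontrivial restrictions `r` becomes active at some fixed depth `d r`.
So a word of length `k` with restriction `r` is a prefix of an active word of length `k + d r`, and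
summing over `r` gives the bound. -/
theorem mem_boundedAut_iff (g : treeAut X) :
    g ∈ boundedAut X ↔ IsFiniteState g ∧ ∃ C : ℕ, ∀ k, (support g k).ncard ≤ C := by
  rw [boundedAut, Set.mem_ofPred_eq, isFiniteAutomatic_iff]
  refine and_congr_right fun hfin => ⟨?_, ?_⟩
  · rintro ⟨C, hC⟩
    let act : ℕ → Set (List X) := fun k => {v | v.length = k ∧ ∃ x, (restrict g v).1 [x] ≠ [x]}
    have hact : ∀ k, (act k).Finite := fun k =>
      (List.finite_length_eq X k).subset fun _ h => h.1
    have hd : ∀ r : treeAut X, ∃ d : ℕ, r ≠ 1 →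
        ∃ (w : List X) (x : X), w.length = d ∧ (restrict r w).1 [x] ≠ [x] := fun r => by
      by_cases hr : r = 1
      · exact ⟨0, fun h => absurd hr h⟩
      · obtain ⟨w, x, h⟩ := exists_restrict_apply_singleton_ne hr
        exact ⟨w.length, fun _ => ⟨w, x, rfl, h⟩⟩
    choose d hd using hd
    obtain ⟨C', hC'⟩ := exists_ncard_biUnion_le hfin
      (fun r k => (List.take k) '' act (k + d r))
      fun r _ => ⟨C, fun k => (Set.ncard_image_le (hact _)).trans (hC (k + d r))⟩
    refine ⟨C', fun k => (Set.ncard_le_ncard ?_ ?_).trans (hC' k)⟩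
    · rintro v ⟨hv, hr⟩
      obtain ⟨w, x, hw, hx⟩ := hd _ hr
      rw [Set.mem_iUnion₂]
      exact ⟨_, ⟨v, rfl⟩, v ++ w, ⟨by simp [hv, hw], x, by rwa [restrict_append]⟩,
        by rw [← hv, List.take_left]⟩
    · exact hfin.biUnion fun r _ => (hact _).image _
  · rintro ⟨C, hC⟩
    refine ⟨C, fun k => (Set.ncard_le_ncard ?_ (finite_support g k)).trans (hC k)⟩
    rintro v ⟨hv, x, hx⟩
    exact ⟨hv, fun h => hx (by rw [h, one_apply])⟩

theorem ncard_support_mul_le (g h : treeAut X) (k : ℕ) :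
    (support (g * h) k).ncard ≤ (support g k).ncard + (support h k).ncard := by
  have hs : support (g * h) k ⊆ h⁻¹.1 '' support g k ∪ support h k := by
    rintro v ⟨hv, hr⟩
    by_cases h1 : restrict h v = 1
    · refine Or.inl ⟨h.1 v, ⟨by rw [length_apply, hv], fun h2 => hr ?_⟩, inv_apply_apply h v⟩
      rw [restrict_mul, h1, h2, one_mul]
    · exact Or.inr ⟨hv, h1⟩
  refine (Set.ncard_le_ncard hs (((finite_support g k).image _).union (finite_support h k))).trans ?_
  exact (Set.ncard_union_le _ _).trans
    (Nat.add_le_add_right (Set.ncard_image_le (finite_support g k)) _)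

theorem ncard_support_inv_le (g : treeAut X) (k : ℕ) :
    (support g⁻¹ k).ncard ≤ (support g k).ncard := by
  have hs : support g⁻¹ k ⊆ g.1 '' support g k := by
    rintro v ⟨hv, hr⟩
    refine ⟨g⁻¹.1 v, ⟨by rw [length_apply, hv], fun h2 => hr ?_⟩, apply_inv_apply g v⟩
    rw [restrict_inv, h2, inv_one]
  exact (Set.ncard_le_ncard hs ((finite_support g k).image _)).trans
    (Set.ncard_image_le (finite_support g k))

variable (X) in
/-- The group of bounded automorphisms. -/
def boundedSubgroup : Subgroup (treeAut X) where
  carrier := boundedAut X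
  one_mem' := (mem_boundedAut_iff _).2 ⟨IsFiniteState.one, 0, fun k => by
    have : support (1 : treeAut X) k = ∅ :=
      Set.eq_empty_of_forall_notMem fun v hv => hv.2 (restrict_one v)
    rw [this, Set.ncard_empty]⟩
  mul_mem' := by
    intro g h hg hh
    obtain ⟨hg, C, hC⟩ := (mem_boundedAut_iff _).1 hg
    obtain ⟨hh, D, hD⟩ := (mem_boundedAut_iff _).1 hh
    exact (mem_boundedAut_iff _).2 ⟨hg.mul hh, C + D, fun k =>
      (ncard_support_mul_le g h k).trans (Nat.add_le_add (hC k) (hD k))⟩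
  inv_mem' := by
    intro g hg
    obtain ⟨hg, C, hC⟩ := (mem_boundedAut_iff _).1 hg
    exact (mem_boundedAut_iff _).2 ⟨hg.inv, C, fun k => (ncard_support_inv_le g k).trans (hC k)⟩

end SelfSimilarGroup

namespace SelfSimilarGroup

variable {X : Type*}

/-! ### Finitary automorphisms and circuits -/

/-- The automorphisms with trivial restrictions on level `n`. -/
def finitaryAt (X : Type*) (n : ℕ) : Subgroup (treeAut X) where
  carrier := {g | ∀ v : List X, v.length = n → restrict g v = 1}
  one_mem' := fun v _ => restrict_one v
  mul_mem' := fun {g h} hg hh v hv => by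
    rw [restrict_mul, hh v hv, hg _ (by rw [length_apply, hv]), one_mul]
  inv_mem' := fun {g} hg v hv => by
    rw [restrict_inv, hg _ (by rw [length_apply, hv]), inv_one]

theorem finitaryAt_mono {m n : ℕ} (h : m ≤ n) : finitaryAt X m ≤ finitaryAt X n := by
  intro g hg v hv
  rw [← List.take_append_drop m v, restrict_append, hg _ (by simp [hv, h]), restrict_one]

/-- `g` is finitary if its restrictions on some level are trivial. -/
def IsFinitary (g : treeAut X) : Prop := ∃ n, g ∈ finitaryAt X n

theorem IsFinitary.restrict {g : treeAut X} (hg : IsFinitary g) (v : List X) :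
    IsFinitary (restrict g v) := by
  obtain ⟨n, hn⟩ := hg
  refine ⟨n, fun w hw => ?_⟩
  rw [← restrict_append]
  exact finitaryAt_mono (Nat.le_add_left n v.length) hn _ (by simp [hw])

/-- The automorphisms `g` with `g|_u = g` for a word `u` of length `n`, the restrictions in the
other words of length `n` being finitary of depth `n`. -/
def circuit (X : Type*) (n : ℕ) : Set (treeAut X) :=
  {g | ∃ u : List X, u.length = n ∧ restrict g u = g ∧
    ∀ v : List X, v.length = n → v ≠ u → restrict g v ∈ finitaryAt X n}

/-- The finitary automorphisms of depth `n` and the circuits of length `n`. -/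
def atoms (X : Type*) (n : ℕ) : Set (treeAut X) :=
  finitaryAt X n ∪ circuit X n

theorem one_mem_atoms (n : ℕ) : (1 : treeAut X) ∈ atoms X n := Or.inl (one_mem _)

theorem restrict_mem_or_eq_of_mem_atoms {n : ℕ} {g : treeAut X} (hg : g ∈ atoms X n) {v : List X}
    (hv : v.length = n) : restrict g v ∈ finitaryAt X n ∨ restrict g v = g := by
  rcases hg with hg | ⟨u, hu, hr, h⟩
  · exact Or.inl (by rw [hg v hv]; exact one_mem _)
  · by_cases hvu : v = u
    · exact Or.inr (hvu ▸ hr)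
    · exact Or.inl (h v hv hvu)

theorem restrict_mem_atoms {n : ℕ} {g : treeAut X} (hg : g ∈ atoms X n) {v : List X}
    (hv : v.length = n) : restrict g v ∈ atoms X n := by
  rcases restrict_mem_or_eq_of_mem_atoms hg hv with h | h
  · exact Or.inl h
  · rwa [h]

theorem restrict_mem_atoms_mul {n : ℕ} {g : treeAut X} (hg : g ∈ atoms X n) (k : ℕ) {v : List X}
    (hv : v.length = k * n) : restrict g v ∈ atoms X n := by
  induction k generalizing g v with
  | zero =>
    have hv0 : v = [] := List.eq_nil_of_length_eq_zero (by simpa using hv)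
    rwa [hv0, restrict_nil]
  | succ k ih =>
    rw [← List.take_append_drop n v, restrict_append]
    have : n ≤ (k + 1) * n := Nat.le_mul_of_pos_left n k.succ_pos
    refine ih (restrict_mem_atoms hg (by rw [List.length_take, hv, min_eq_left this])) ?_
    rw [List.length_drop, hv, Nat.succ_mul, Nat.add_sub_cancel]

theorem inv_mem_atoms {n : ℕ} {g : treeAut X} (hg : g ∈ atoms X n) : g⁻¹ ∈ atoms X n := by
  rcases hg with hg | ⟨u, hu, hr, h⟩
  · exact Or.inl (inv_mem hg)
  · refine Or.inr ⟨g.1 u, by rw [length_apply, hu], ?_, fun v hv hvu => ?_⟩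
    · rw [restrict_inv, inv_apply_apply, hr]
    · rw [restrict_inv]
      refine inv_mem (h _ (by rw [length_apply, hv]) fun h1 => hvu ?_)
      rw [← h1, apply_inv_apply]

theorem restrict_mul_mem_atoms_of_left {n : ℕ} {g h : treeAut X} (hg : g ∈ finitaryAt X n)
    (hh : h ∈ atoms X n) {v : List X} (hv : v.length = n) : restrict (g * h) v ∈ atoms X n := by
  rw [restrict_mul, hg _ (by rw [length_apply, hv]), one_mul]
  exact restrict_mem_atoms hh hv

theorem restrict_mul_mem_atoms_of_right {n : ℕ} {g h : treeAut X} (hg : g ∈ atoms X n)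
    (hh : h ∈ finitaryAt X n) {v : List X} (hv : v.length = n) :
    restrict (g * h) v ∈ atoms X n := by
  rw [restrict_mul, hh v hv, mul_one]
  exact restrict_mem_atoms hg (by rw [length_apply, hv])

/-- The restrictions of a product of two atoms on level `2n` are atoms. -/
theorem restrict_mul_mem_atoms {n : ℕ} {g h : treeAut X} (hg : g ∈ atoms X n) (hh : h ∈ atoms X n)
    {v w : List X} (hv : v.length = n) (hw : w.length = n) :
    restrict (g * h) (v ++ w) ∈ atoms X n := by
  have hhv : (h.1 v).length = n := by rw [length_apply, hv]
  rw [restrict_append]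
  by_cases h1 : restrict g (h.1 v) ∈ finitaryAt X n
  · rw [restrict_mul]
    exact restrict_mul_mem_atoms_of_left h1 (restrict_mem_atoms hh hv) hw
  by_cases h2 : restrict h v ∈ finitaryAt X n
  · rw [restrict_mul]
    exact restrict_mul_mem_atoms_of_right (restrict_mem_atoms hg hhv) h2 hw
  -- In the remaining case both factors reproduce themselves and the circuits are aligned: that of
  -- `h` runs along `v` and that of `g` along `h(v)`. Hence `gh` is a circuit along `v`.
  have hg1 := (restrict_mem_or_eq_of_mem_atoms hg hhv).resolve_left h1
  have hh1 := (restrict_mem_or_eq_of_mem_atoms hh hv).resolve_left h2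
  have hgC : ∀ u : List X, u.length = n → u ≠ h.1 v → restrict g u ∈ finitaryAt X n := by
    rcases hg with hg | ⟨u, -, -, hu⟩
    · exact absurd (by rw [hg1]; exact hg) h1
    · have : h.1 v = u := by
        by_contra hne
        exact h1 (hu _ hhv hne)
      rwa [this]
  have hhC : ∀ u : List X, u.length = n → u ≠ v → restrict h u ∈ finitaryAt X n := by
    rcases hh with hh | ⟨u, -, -, hu⟩
    · exact absurd (by rw [hh1]; exact hh) h2
    · have : v = u := by
        by_contra hne
        exact h2 (hu _ hv hne)
      rwa [this]
  have hgh : restrict (g * h) v = g * h := by rw [restrict_mul, hg1, hh1]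
  rw [hgh]
  refine restrict_mem_atoms (Or.inr ⟨v, hv, hgh, fun u hu huv => ?_⟩) hw
  rw [restrict_mul]
  exact mul_mem (hgC _ (by rw [length_apply, hu]) fun h3 => huv (h.1.injective h3)) (hhC u hu huv)

/-- The automorphisms whose deep restrictions are atoms. -/
def atomicSubgroup (X : Type*) (n : ℕ) : Subgroup (treeAut X) where
  carrier := {g | ∃ k : ℕ, ∀ v : List X, v.length = k * n → restrict g v ∈ atoms X n}
  one_mem' := ⟨0, fun v _ => by rw [restrict_one]; exact one_mem_atoms n⟩
  mul_mem' := by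
    rintro g h ⟨k, hk⟩ ⟨l, hl⟩
    have mono : ∀ {a b : ℕ} {f : treeAut X},
        (∀ v : List X, v.length = a * n → restrict f v ∈ atoms X n) →
        ∀ v : List X, v.length = (a + b) * n → restrict f v ∈ atoms X n := fun {a b f} hf v hv => by
      rw [add_mul] at hv
      rw [← List.take_append_drop (a * n) v, restrict_append]
      exact restrict_mem_atoms_mul (hf _ (by simp [hv])) b (by simp [hv])
    -- On level `(k + l) * n` both factors restrict to atoms; two further blocks of length `n` turn
    -- their product into an atom.
    refine ⟨k + l + 2, fun v hv => ?_⟩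
    obtain ⟨a, b, c, rfl, ha, hb, hc⟩ : ∃ a b c : List X, v = a ++ (b ++ c) ∧
        a.length = (k + l) * n ∧ b.length = n ∧ c.length = n := by
      rw [add_mul, two_mul] at hv
      refine ⟨v.take ((k + l) * n), (v.drop ((k + l) * n)).take n, (v.drop ((k + l) * n)).drop n,
        ?_, ?_, ?_, ?_⟩
      · rw [List.take_append_drop, List.take_append_drop]
      all_goals simp only [List.length_take, List.length_drop, hv]; omega
    rw [restrict_append, restrict_mul]
    refine restrict_mul_mem_atoms (mono hk _ (by rw [length_apply, ha])) ?_ hb hc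
    rw [add_comm] at ha
    exact mono hl _ ha
  inv_mem' := by
    rintro g ⟨k, hk⟩
    refine ⟨k, fun v hv => ?_⟩
    rw [restrict_inv]
    exact inv_mem_atoms (hk _ (by rw [length_apply, hv]))

/-! ### Finiteness of the set of atoms -/

theorem apply_eq_of_level_eq {n : ℕ} {g h : treeAut X}
    (H : ∀ v : List X, v.length = n → g.1 v = h.1 v) {v : List X} (hv : v.length ≤ n) :
    g.1 v = h.1 v := by
  cases v with
  | nil => rw [apply_nil, apply_nil]
  | cons x t =>
    -- The word is padded to length `n` with its own first letter, as no other letter is available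
    -- in general.
    have h1 := H ((x :: t) ++ List.replicate (n - (x :: t).length) x) (by
      rw [List.length_append, List.length_replicate]; omega)
    rw [apply_append_eq g, apply_append_eq h] at h1
    exact (List.append_inj h1 (by rw [length_apply, length_apply])).1

theorem eq_of_level_eq {n : ℕ} (hn : 0 < n) {g h : treeAut X}
    (H : ∀ v : List X, v.length = n → g.1 v = h.1 v)
    (H' : ∀ v : List X, v.length = n →
      restrict g v = restrict h v ∨ (restrict g v = g ∧ restrict h v = h)) : g = h := by
  refine treeAut_ext fun w => ?_
  induction hl : w.length using Nat.strong_induction_on generalizing w with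
  | _ l ih =>
    by_cases hln : l ≤ n
    · exact apply_eq_of_level_eq H (hl.trans_le hln)
    · have ht : (w.take n).length = n := by rw [List.length_take]; omega
      rw [← List.take_append_drop n w, apply_append_eq g, apply_append_eq h, H _ ht]
      congr 1
      rcases H' _ ht with h1 | ⟨h1, h2⟩
      · rw [h1]
      · rw [h1, h2]
        exact ih (l - n) (by omega) _ (by rw [List.length_drop, hl])

variable [Finite X]

/-- An element of `S` is coded by its permutation of level `n` and its restrictions there, with
`none` for a restriction outside `F`, which must be the element itself. `eq_of_level_eq` decodes
this recursively, and there are finitely many codes. -/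
theorem finite_of_code {n : ℕ} (hn : 0 < n) {S : Set (treeAut X)} {F : Set (treeAut X)}
    (hF : F.Finite) (hS : ∀ g ∈ S, ∀ v : List X, v.length = n →
      restrict g v ∈ F ∨ restrict g v = g) : S.Finite := by
  classical
  have := hF.to_subtype
  have : Finite {v : List X // v.length = n} := (List.finite_length_eq X n).to_subtype
  let code : treeAut X → ({v : List X // v.length = n} → {v : List X // v.length = n}) ×
      ({v : List X // v.length = n} → Option F) := fun g =>
    (fun v => ⟨g.1 v.1, by rw [length_apply, v.2]⟩,
      fun v => if h : restrict g v.1 ∈ F then some ⟨_, h⟩ else none)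
  refine Set.Finite.of_finite_image (f := code) (Set.toFinite _) ?_
  intro g hg h hh hgh
  refine eq_of_level_eq hn (fun v hv => ?_) fun v hv => ?_
  · exact congrArg Subtype.val (congrFun (congrArg Prod.fst hgh) ⟨v, hv⟩)
  · have h2 := congrFun (congrArg Prod.snd hgh) ⟨v, hv⟩
    simp only [code] at h2
    by_cases h3 : restrict g v ∈ F <;> by_cases h4 : restrict h v ∈ F
    · simp only [h3, h4, dite_true] at h2
      exact Or.inl (congrArg Subtype.val (Option.some.inj h2))
    · simp [h3, h4] at h2
    · simp [h3, h4] at h2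
    · exact Or.inr ⟨(hS g hg v hv).resolve_left h3, (hS h hh v hv).resolve_left h4⟩

theorem finite_finitaryAt {n : ℕ} (hn : 0 < n) : (finitaryAt X n : Set (treeAut X)).Finite :=
  finite_of_code hn (Set.finite_singleton 1) fun _ hg v hv => Or.inl (hg v hv)

theorem finite_atoms {n : ℕ} (hn : 0 < n) : (atoms X n).Finite :=
  finite_of_code hn (finite_finitaryAt hn) fun _ hg _ hv => restrict_mem_or_eq_of_mem_atoms hg hv

theorem finite_restrict_atoms {n : ℕ} (hn : 0 < n) :
    {g | ∃ h ∈ atoms X n, ∃ v, restrict h v = g}.Finite := by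
  refine (Set.Finite.image2 restrict (finite_atoms hn) (List.finite_length_lt X n)).subset ?_
  rintro g ⟨h, hh, v, rfl⟩
  induction hl : v.length using Nat.strong_induction_on generalizing v h with
  | _ l ih =>
    by_cases hln : l < n
    · exact ⟨h, hh, v, hl.trans_lt hln, rfl⟩
    · rw [← List.take_append_drop n v, restrict_append]
      exact ih (l - n) (by omega) _ (restrict_mem_atoms hh (by rw [List.length_take]; omega)) _
        (by rw [List.length_drop, hl])

end SelfSimilarGroup

namespace SelfSimilarGroup

variable {X : Type*}

/-! ### Deep restrictions of bounded automorphisms are atoms -/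

/-- The words `v` of length `k` for which `g|_v` is not finitary. -/
def nonfinitarySupport (g : treeAut X) (k : ℕ) : Set (List X) :=
  {v | v.length = k ∧ ¬ IsFinitary (restrict g v)}

theorem finite_nonfinitarySupport [Finite X] (g : treeAut X) (k : ℕ) : (nonfinitarySupport g k).Finite :=
  (List.finite_length_eq X k).subset fun _ h => h.1

theorem exists_finitaryAt_of_finite {S : Set (treeAut X)} (hS : S.Finite)
    (h : ∀ g ∈ S, IsFinitary g) : ∃ n, ∀ g ∈ S, g ∈ finitaryAt X n := by
  choose! d hd using h
  obtain ⟨n, hn⟩ := (hS.image d).bddAbove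
  exact ⟨n, fun g hg => finitaryAt_mono (hn ⟨g, hg, rfl⟩) (hd g hg)⟩

theorem exists_not_isFinitary_restrict [Finite X] {g : treeAut X} (hg : ¬ IsFinitary g) :
    ∃ x : X, ¬ IsFinitary (restrict g [x]) := by
  by_contra! H
  obtain ⟨n, hn⟩ := exists_finitaryAt_of_finite (Set.finite_range fun x => restrict g [x])
    (by rintro _ ⟨x, rfl⟩; exact H x)
  refine hg ⟨n + 1, fun v hv => ?_⟩
  obtain ⟨x, w, rfl⟩ := List.exists_cons_of_length_eq_add_one hv
  rw [restrict_cons]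
  exact hn _ ⟨x, rfl⟩ w (by simpa using hv)

open Classical in
/-- The restriction of a non-finitary automorphism in some letter, chosen to be non-finitary. -/
noncomputable def nonfinitaryChild [Finite X] (g : treeAut X) : treeAut X :=
  if h : ¬ IsFinitary g then restrict g [(exists_not_isFinitary_restrict h).choose] else g

theorem exists_iterate_nonfinitaryChild [Finite X] {g : treeAut X} (hg : ¬ IsFinitary g) (j : ℕ) :
    ∃ w : List X, w.length = j ∧ restrict g w = nonfinitaryChild^[j] g ∧
      ¬ IsFinitary (restrict g w) := by
  induction j with
  | zero => exact ⟨[], rfl, restrict_nil g, by rwa [restrict_nil]⟩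
  | succ j ih =>
    obtain ⟨w, hw, h1, h2⟩ := ih
    have h3 : nonfinitaryChild (restrict g w) =
        restrict (restrict g w) [(exists_not_isFinitary_restrict h2).choose] := dif_pos h2
    refine ⟨w ++ [(exists_not_isFinitary_restrict h2).choose], by simp [hw], ?_, ?_⟩
    · rw [Function.iterate_succ_apply', ← h1, h3, restrict_append]
    · rw [restrict_append]
      exact (exists_not_isFinitary_restrict h2).choose_spec

/-- A finite orbit is eventually periodic, and `m!` is a multiple of the period once `m` is at least
the period. Factorials thus serve as common periods for several orbits. -/
theorem exists_iterate_add_factorial_eq {α : Type*} (f : α → α) (a : α)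
    (h : (Set.range fun j => f^[j] a).Finite) :
    ∃ M, ∀ m ≥ M, ∀ k ≥ M, f^[k + m.factorial] a = f^[k] a := by
  have hni : ¬ Function.Injective fun j => f^[j] a := fun hi => Set.infinite_range_of_injective hi h
  obtain ⟨i, j, hij, hlt⟩ : ∃ i j, f^[i] a = f^[j] a ∧ i < j := by
    simp only [Function.Injective, not_forall] at hni
    obtain ⟨i, j, h1, h2⟩ := hni
    rcases lt_or_gt_of_ne h2 with h3 | h3
    · exact ⟨i, j, h1, h3⟩
    · exact ⟨j, i, h1.symm, h3⟩
  have hstep : ∀ k ≥ i, f^[k + (j - i)] a = f^[k] a := fun k hk => by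
    have h1 : k + (j - i) = (k - i) + j := by omega
    rw [h1, Function.iterate_add_apply, ← hij, ← Function.iterate_add_apply, Nat.sub_add_cancel hk]
  have hmul : ∀ c, ∀ k ≥ i, f^[k + (j - i) * c] a = f^[k] a := fun c k hk => by
    induction c with
    | zero => rfl
    | succ c ih => rw [Nat.mul_succ, ← Nat.add_assoc, hstep _ (by omega), ih]
  refine ⟨j, fun m hm k hk => ?_⟩
  obtain ⟨c, hc⟩ : j - i ∣ m.factorial := Nat.dvd_factorial (by omega) (by omega)
  rw [hc]
  exact hmul c k (by omega)

theorem nonfinitarySupport_subset_support (g : treeAut X) (k : ℕ) :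
    nonfinitarySupport g k ⊆ support g k := fun _ hv =>
  ⟨hv.1, fun h => hv.2 ⟨0, by rw [h]; exact one_mem _⟩⟩

theorem take_mem_nonfinitarySupport {g : treeAut X} {k l : ℕ} (hkl : k ≤ l) {v : List X}
    (hv : v ∈ nonfinitarySupport g l) : v.take k ∈ nonfinitarySupport g k := by
  refine ⟨by rw [List.length_take, hv.1, min_eq_left hkl], fun h => hv.2 ?_⟩
  rw [← List.take_append_drop k v, restrict_append]
  exact h.restrict _

theorem exists_append_mem_nonfinitarySupport [Finite X] {g : treeAut X} {k : ℕ} (j : ℕ) {v : List X}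
    (hv : v ∈ nonfinitarySupport g k) :
    ∃ w : List X, w.length = j ∧ v ++ w ∈ nonfinitarySupport g (k + j) ∧
      restrict g (v ++ w) = nonfinitaryChild^[j] (restrict g v) := by
  obtain ⟨w, hw, h1, h2⟩ := exists_iterate_nonfinitaryChild hv.2 j
  exact ⟨w, hw, ⟨by rw [List.length_append, hv.1, hw], by rwa [restrict_append]⟩,
    by rw [restrict_append, h1]⟩

/-- From some level on, a non-finitary restriction of a bounded automorphism has a unique
non-finitary restriction on every further level. -/
theorem exists_injOn_take [Finite X] {g : treeAut X} (hg : ∃ C : ℕ, ∀ k, (support g k).ncard ≤ C) :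
    ∃ k, ∀ l ≥ k, Set.InjOn (List.take k) (nonfinitarySupport g l) := by
  obtain ⟨C, hC⟩ := hg
  have hbd : BddAbove (Set.range fun k => (nonfinitarySupport g k).ncard) := by
    refine ⟨C, ?_⟩
    rintro _ ⟨k, rfl⟩
    exact (Set.ncard_le_ncard (nonfinitarySupport_subset_support g k)
      (finite_support g k)).trans (hC k)
  -- The level `k` maximises the number of non-finitary restrictions. Truncation from a deeper level
  -- to `k` is onto, because non-finitary words extend, and the deeper level is no larger, so
  -- truncation is injective.
  obtain ⟨k, hk⟩ := Nat.sSup_mem (Set.range_nonempty _) hbd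
  refine ⟨k, fun l hl v hv w hw hvw => ?_⟩
  refine Set.inj_on_of_surj_on_of_ncard_le (t := nonfinitarySupport g k) (fun v _ => v.take k)
    (fun v hv => take_mem_nonfinitarySupport hl hv) (fun u hu => ?_) ?_ hv hw hvw
    (finite_nonfinitarySupport g l)
  · obtain ⟨t, -, h, -⟩ := exists_append_mem_nonfinitarySupport (l - k) hu
    rw [Nat.add_sub_cancel' hl] at h
    exact ⟨_, h, by rw [← hu.1, List.take_left]⟩
  · rw [show (nonfinitarySupport g k).ncard = _ from hk]
    exact le_csSup hbd ⟨l, rfl⟩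

/-- A non-finitary `g|_v` on level `m!` lies on the unique non-finitary path below its prefix of
length `k`. That path is already periodic there with period dividing `m!`, so going down another
`m!` letters returns to `g|_v`, and all other branches are finitary. -/
theorem eventually_restrict_mem_atoms [Finite X] {g : treeAut X} (hg : g ∈ boundedAut X) :
    ∀ᶠ m : ℕ in Filter.atTop, ∀ v : List X, v.length = m.factorial →
      restrict g v ∈ atoms X m.factorial := by
  obtain ⟨hfin, hbd⟩ := (mem_boundedAut_iff g).1 hg
  obtain ⟨k, hk⟩ := exists_injOn_take hbd
  obtain ⟨D, hD⟩ := exists_finitaryAt_of_finite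
    (hfin.subset (Set.inter_subset_left (t := {h | IsFinitary h}))) fun _ h => h.2
  have hper : ∀ v ∈ nonfinitarySupport g k, ∀ᶠ M in Filter.atTop, ∀ m ≥ M, ∀ l ≥ M,
      nonfinitaryChild^[l + m.factorial] (restrict g v) =
        nonfinitaryChild^[l] (restrict g v) := by
    intro v hv
    obtain ⟨M, hM⟩ := exists_iterate_add_factorial_eq nonfinitaryChild (restrict g v) (by
      refine hfin.subset ?_
      rintro _ ⟨j, rfl⟩
      obtain ⟨w, -, -, h⟩ := exists_append_mem_nonfinitarySupport j hv
      exact ⟨_, h⟩)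
    filter_upwards [Filter.eventually_ge_atTop M] with N hN m hm l hl
    exact hM m (hN.trans hm) l (hN.trans hl)
  obtain ⟨M, hM⟩ := ((Filter.eventually_all_finite (finite_nonfinitarySupport g k)).2 hper).exists
  filter_upwards [Filter.eventually_ge_atTop (max D (M + k))] with m hm v hv
  have hmm : m ≤ m.factorial := Nat.self_le_factorial m
  set n := m.factorial with hn
  have hDn : D ≤ n := (le_max_left _ _).trans (hm.trans hmm)
  have hMn : M + k ≤ n := (le_max_right _ _).trans (hm.trans hmm)
  have hMm : M ≤ m := (Nat.le_add_right _ _).trans ((le_max_right _ _).trans hm)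
  by_cases hf : IsFinitary (restrict g v)
  · exact Or.inl (finitaryAt_mono hDn (hD _ ⟨⟨v, rfl⟩, hf⟩))
  have hv' : v ∈ nonfinitarySupport g n := ⟨hv, hf⟩
  have hp := take_mem_nonfinitarySupport (by omega : k ≤ n) hv'
  obtain ⟨w, hw, hw1, hw2⟩ := exists_append_mem_nonfinitarySupport (n - k) hp
  have hvw : v.take k ++ w = v := by
    have h1 : k + (n - k) = n := by omega
    rw [h1] at hw1
    exact hk n (by omega) hw1 hv' (List.take_left' hp.1)
  rw [hvw] at hw2
  obtain ⟨u, hu, hu1, hu2⟩ := exists_append_mem_nonfinitarySupport n hv'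
  refine Or.inr ⟨u, hu, ?_, fun t ht htu => ?_⟩
  · rw [← restrict_append, hu2, hw2, ← Function.iterate_add_apply, Nat.add_comm]
    exact hM _ hp m hMm _ (by omega)
  · by_contra hnf
    have hnf' : ¬ IsFinitary (restrict g (v ++ t)) := fun h =>
      hnf (by rw [← restrict_append]; exact finitaryAt_mono hDn (hD _ ⟨⟨_, rfl⟩, h⟩))
    -- A second non-finitary branch `t` would give two non-finitary words `vt`, `vu` with the same
    -- prefix of length `k`.
    have h1 := hk (n + n) (by omega) (x₁ := v ++ t) ⟨by rw [List.length_append, hv, ht], hnf'⟩ hu1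
      (by rw [List.take_append_of_le_length (by omega), List.take_append_of_le_length (by omega)])
    exact htu (List.append_cancel_left h1)

/-! ### Contraction -/

theorem completeAutomaton_transWord {G : Subgroup (treeAut X)} (hG : IsSelfSimilar G) (g : G)
    (v : List X) : ((completeAutomaton G hG).transWord g v).1 = restrict g.1 v := by
  induction v generalizing g with
  | nil => exact (restrict_nil g.1).symm
  | cons x v ih =>
    rw [restrict_cons]
    exact ih _

theorem IsSelfSimilar.restrict_word_mem {G : Subgroup (treeAut X)} (hG : IsSelfSimilar G)
    {g : treeAut X} (hg : g ∈ G) (v : List X) : restrict g v ∈ G := by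
  rw [← completeAutomaton_transWord hG ⟨g, hg⟩]
  exact Subtype.prop _

/-- `N` is a finite subset of `G` that is closed under restrictions and contains all deep
restrictions of elements of `G`. -/
structure IsNucleus (G : Subgroup (treeAut X)) (N : Set (treeAut X)) : Prop where
  finite : N.Finite
  subset : N ⊆ G
  restrict_mem : ∀ g ∈ N, ∀ v, restrict g v ∈ N
  absorbing : ∀ g ∈ G, ∃ n : ℕ, ∀ v : List X, n ≤ v.length → restrict g v ∈ N

theorem isContracting_iff {G : Subgroup (treeAut X)} (hG : IsSelfSimilar G) :
    IsContracting G ↔ ∃ N, IsNucleus G N := by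
  constructor
  · rintro ⟨_, N, hN, hsub, habs⟩
    refine ⟨Subtype.val '' N, hN.image _, ?_, ?_, ?_⟩
    · rintro _ ⟨g, -, rfl⟩
      exact g.2
    · rintro _ ⟨g, hg, rfl⟩ v
      induction v generalizing g with
      | nil => exact ⟨g, hg, (restrict_nil _).symm⟩
      | cons x v ih =>
        rw [restrict_cons]
        exact ih _ (hsub g hg x)
    · intro g hg
      obtain ⟨n, hn⟩ := habs ⟨g, hg⟩
      exact ⟨n, fun v hv => ⟨_, hn v hv, completeAutomaton_transWord hG _ v⟩⟩
  · rintro ⟨N, hN⟩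
    refine ⟨hG, Subtype.val ⁻¹' N, hN.finite.preimage Subtype.val_injective.injOn,
      fun g hg x => hN.restrict_mem _ hg [x], fun g => ?_⟩
    obtain ⟨n, hn⟩ := hN.absorbing g.1 g.2
    refine ⟨n, fun v hv => ?_⟩
    rw [Set.mem_preimage, completeAutomaton_transWord]
    exact hn v hv

/-- Finite generation provides a single `n` for all generators. Since `atomicSubgroup` is a group,
it contains `G`, and the deep restrictions in `G` are restrictions of the finitely many atoms. -/
theorem exists_isNucleus_of_subset_boundedAut [Finite X] {G : Subgroup (treeAut X)} (hfg : G.FG)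
    (hG : IsSelfSimilar G) (hB : (G : Set (treeAut X)) ⊆ boundedAut X) : ∃ N, IsNucleus G N := by
  obtain ⟨S, hS⟩ := hfg
  have hSG : ∀ s ∈ S, s ∈ G := fun s hs => hS ▸ Subgroup.subset_closure hs
  obtain ⟨m, hm⟩ := ((Filter.eventually_all_finset S).2 fun s hs =>
    eventually_restrict_mem_atoms (hB (hSG s hs))).exists
  set n := m.factorial
  have hn : 0 < n := m.factorial_pos
  have hle : G ≤ atomicSubgroup X n := by
    rw [← hS, Subgroup.closure_le]
    exact fun s hs => ⟨1, fun v hv => hm s hs v (by rw [hv, one_mul])⟩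
  refine ⟨{g | g ∈ G ∧ ∃ h ∈ atoms X n, ∃ v, restrict h v = g},
    (finite_restrict_atoms hn).subset fun _ h => h.2, fun _ h => h.1, ?_, ?_⟩
  · rintro _ ⟨hg, h, hh, v, rfl⟩ w
    exact ⟨hG.restrict_word_mem hg w, h, hh, v ++ w, restrict_append h v w⟩
  · intro g hg
    obtain ⟨k, hk⟩ := hle hg
    refine ⟨k * n, fun v hv => ⟨hG.restrict_word_mem hg v, restrict g (v.take (k * n)),
      hk _ (by rw [List.length_take, min_eq_left hv]), v.drop (k * n), ?_⟩⟩
    rw [← restrict_append, List.take_append_drop]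

end SelfSimilarGroup

namespace SelfSimilarGroup

variable {X : Type*}

/-! ### Left-infinite sequences -/

theorem length_endWord (x : ℕ → X) (k : ℕ) : (endWord x k).length = k := by
  induction k with
  | zero => rfl
  | succ k ih => rw [endWord, List.length_cons, ih]

theorem endWord_add (x : ℕ → X) (k m : ℕ) :
    endWord x (k + m) = endWord (fun i => x (k + i)) m ++ endWord x k := by
  induction m with
  | zero => rfl
  | succ m ih => rw [← Nat.add_assoc, endWord, ih]; rfl

theorem endWord_injective {x y : ℕ → X} (h : ∀ k, endWord x k = endWord y k) : x = y :=
  funext fun k => (List.cons.inj (h (k + 1))).1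

theorem endWord_eq_of_le {x y : ℕ → X} {k l : ℕ} (hkl : k ≤ l) (h : endWord x l = endWord y l) :
    endWord x k = endWord y k := by
  obtain ⟨m, rfl⟩ := Nat.exists_eq_add_of_le hkl
  rw [endWord_add, endWord_add] at h
  exact (List.append_inj h (by rw [length_endWord, length_endWord])).2

theorem exists_endWord_eq (w : List X) (z : ℕ → X) :
    ∃ x, endWord x w.length = w ∧ ∀ i, x (w.length + i) = z i := by
  induction w generalizing z with
  | nil => exact ⟨z, rfl, fun i => by rw [List.length_nil, Nat.zero_add]⟩
  | cons a t ih =>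
    obtain ⟨x, hx, hz⟩ := ih (fun i => Nat.casesOn i a z)
    refine ⟨x, ?_, fun i => ?_⟩
    · rw [List.length_cons, endWord, hx]
      exact congrArg (· :: t) (hz 0)
    · rw [List.length_cons, Nat.add_assoc, Nat.add_comm 1 i]
      exact hz (i + 1)

/-- Among `C + 1` distinct sequences all ends of sufficiently large length are distinct. -/
theorem finite_of_ncard_endWord_le [Finite X] {S : Set (ℕ → X)} {l C : ℕ}
    (h : ∀ k ≥ l, ((fun x => endWord x k) '' S).ncard ≤ C) : S.Finite := by
  by_contra hS
  obtain ⟨T, hTS, hT, hcard⟩ := Set.Infinite.exists_subset_ncard_eq hS (C + 1)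
  have hev : ∀ᶠ k in Filter.atTop, ∀ x ∈ T, ∀ y ∈ T, endWord x k = endWord y k → x = y := by
    refine (Filter.eventually_all_finite hT).2 fun x _ => (Filter.eventually_all_finite hT).2
      fun y _ => ?_
    by_cases hxy : x = y
    · exact Filter.Eventually.of_forall fun _ _ => hxy
    · obtain ⟨j, hj⟩ : ∃ j, endWord x j ≠ endWord y j := by
        by_contra! H
        exact hxy (endWord_injective H)
      filter_upwards [Filter.eventually_ge_atTop j] with k hk hxy'
      exact absurd (endWord_eq_of_le hk hxy') hj
  obtain ⟨k, hk, hkl⟩ := (hev.and (Filter.eventually_ge_atTop l)).exists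
  have hfin : ((fun x => endWord x k) '' S).Finite := (List.finite_length_eq X k).subset (by
    rintro _ ⟨x, -, rfl⟩
    exact length_endWord x k)
  have h1 := Set.ncard_le_ncard (Set.image_mono (f := fun x => endWord x k) hTS) hfin
  rw [Set.InjOn.ncard_image fun x hx y hy => hk x hx y hy, hcard] at h1
  exact absurd (h1.trans (h k hkl)) (by omega)

/-! ### Asymptotic equivalence and the nucleus -/

/-- The finitely many values of the sequence `g` are absorbed by the nucleus after a common number
`m` of letters, so the element acting on the end of length `k + m` is restricted along its first `m`
letters. -/
theorem AsympEquiv.exists_mem_nucleus {G : Subgroup (treeAut X)} {N : Set (treeAut X)}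
    (hN : IsNucleus G N) {x y : ℕ → X} (h : AsympEquiv G x y) (k : ℕ) :
    ∃ g ∈ N, g.1 (endWord x k) = endWord y k := by
  obtain ⟨g, hg, hxy⟩ := h
  choose n hn using fun a : G => hN.absorbing a.1 a.2
  obtain ⟨m, hm⟩ := (hg.image n).bddAbove
  refine ⟨restrict (g (k + m)).1 (endWord (fun i => x (k + i)) m), hn _ _ ?_, ?_⟩
  · rw [length_endWord]
    exact hm ⟨_, ⟨k + m, rfl⟩, rfl⟩
  · have h1 := hxy (k + m)
    rw [endWord_add, endWord_add] at h1
    exact (apply_eq_of_apply_append_eq h1 (by rw [length_endWord, length_endWord])).2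

theorem asympEquiv_of_forall_exists_mem {G : Subgroup (treeAut X)} {N : Set (treeAut X)}
    (hN : N.Finite) (hNG : N ⊆ G) {x y : ℕ → X}
    (h : ∀ k, ∃ g ∈ N, g.1 (endWord x k) = endWord y k) : AsympEquiv G x y := by
  choose g hg hxy using h
  refine ⟨fun k => ⟨g k, hNG (hg k)⟩, ?_, hxy⟩
  refine (hN.preimage (Subtype.val_injective (p := (· ∈ G))).injOn).subset ?_
  rintro _ ⟨k, rfl⟩
  exact hg k

theorem finite_setOf_asympEquiv [Finite X] {G : Subgroup (treeAut X)} {N : Set (treeAut X)}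
    (hN : IsNucleus G N) (x : ℕ → X) : {y | AsympEquiv G x y}.Finite := by
  refine finite_of_ncard_endWord_le (l := 0) (C := N.ncard) fun k _ => ?_
  have hs : (fun y => endWord y k) '' {y | AsympEquiv G x y} ⊆
      (fun g : treeAut X => g.1 (endWord x k)) '' N := by
    rintro _ ⟨y, hy, rfl⟩
    exact AsympEquiv.exists_mem_nucleus hN hy k
  exact (Set.ncard_le_ncard hs (hN.finite.image _)).trans (Set.ncard_image_le hN.finite)

theorem LimitSpace.mk_eq_mk {G : Subgroup (treeAut X)} {x y : ℕ → X} :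
    LimitSpace.mk G x = LimitSpace.mk G y ↔ AsympEquiv G x y :=
  Quotient.eq (r := asympSetoid G)

/-! ### Bounded groups have finite intersections of tiles -/

theorem finite_tile_inter_tile [Finite X] {G : Subgroup (treeAut X)} {N : Set (treeAut X)}
    (hN : IsNucleus G N) (hB : (G : Set (treeAut X)) ⊆ boundedAut X) {u v : List X}
    (huv : u.length = v.length) (hne : u ≠ v) : (tile G u ∩ tile G v).Finite := by
  obtain ⟨C, hC⟩ := exists_ncard_biUnion_le hN.finite support fun g hg =>
    ((mem_boundedAut_iff g).1 (hB (hN.subset hg))).2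
  have hfin : {x | endWord x u.length = u ∧
      ∃ y, AsympEquiv G x y ∧ endWord y v.length = v}.Finite := by
    refine finite_of_ncard_endWord_le (l := u.length) (C := C) fun k hk => ?_
    obtain ⟨m, rfl⟩ := Nat.exists_eq_add_of_le hk
    have hU : (⋃ g ∈ N, support g m).Finite :=
      hN.finite.biUnion fun g _ => finite_support g m
    -- Each end of length `u.length + m` is some `wu` with `w` in the support of a nucleus element,
    -- since the restriction at `w` moves `u` to `v`.
    refine (Set.ncard_le_ncard (t := (· ++ u) '' ⋃ g ∈ N, support g m) ?_ (hU.image _)).trans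
      ((Set.ncard_image_le hU).trans (hC m))
    rintro _ ⟨x, ⟨hx, y, hxy, hy⟩, rfl⟩
    obtain ⟨g, hg, hgxy⟩ := hxy.exists_mem_nucleus hN (u.length + m)
    rw [endWord_add, endWord_add, hx] at hgxy
    rw [huv, hy] at hgxy
    have h1 := (apply_eq_of_apply_append_eq hgxy (by rw [length_endWord, length_endWord])).2
    refine ⟨endWord (fun i => x (u.length + i)) m, ?_, ?_⟩
    · rw [Set.mem_iUnion₂]
      refine ⟨g, hg, length_endWord _ _, fun h2 => hne ?_⟩
      rw [← huv] at h1
      rw [h2, one_apply] at h1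
      exact h1
    · change _ ++ u = endWord x (u.length + m)
      rw [endWord_add, hx]
  refine (hfin.image (LimitSpace.mk G)).subset ?_
  rintro _ ⟨⟨x, hx, rfl⟩, ⟨y, hy, hyx⟩⟩
  exact ⟨x, ⟨hx, y, LimitSpace.mk_eq_mk.1 hyx.symm, hy⟩, rfl⟩

/-! ### Groups with finite intersections of tiles are bounded -/

/-- Such points lie in finitely many intersections of tiles of level `d`, and the quotient map has
finite fibres by `finite_setOf_asympEquiv`. -/
theorem finite_setOf_asympEquiv_ne [Finite X] {G : Subgroup (treeAut X)} {N : Set (treeAut X)}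
    (hN : IsNucleus G N)
    (hT : ∀ u v : List X, u.length = v.length → u ≠ v → (tile G u ∩ tile G v).Finite) (d : ℕ) :
    {x | ∃ y, AsympEquiv G x y ∧ endWord x d ≠ endWord y d}.Finite := by
  let P : Set (List X × List X) := {p | (p.1.length = d ∧ p.2.length = d) ∧ p.1 ≠ p.2}
  have hP : P.Finite := (((List.finite_length_eq X d).prod (List.finite_length_eq X d))).subset
    fun p hp => hp.1
  have hU : (⋃ p ∈ P, tile G p.1 ∩ tile G p.2).Finite :=
    hP.biUnion fun p hp => hT _ _ (hp.1.1.trans hp.1.2.symm) hp.2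
  refine (hU.preimage' (f := LimitSpace.mk G) fun b _ => ?_).subset ?_
  · by_cases hb : ∃ x, LimitSpace.mk G x = b
    · obtain ⟨x, rfl⟩ := hb
      exact (finite_setOf_asympEquiv hN x).subset fun y hy => LimitSpace.mk_eq_mk.1 (Eq.symm hy)
    · exact Set.finite_empty.subset fun y hy => (hb ⟨y, hy⟩).elim
  · rintro x ⟨y, hxy, hne⟩
    rw [Set.mem_preimage, Set.mem_iUnion₂]
    refine ⟨(endWord x d, endWord y d), ⟨⟨length_endWord x d, length_endWord y d⟩, hne⟩,
      ⟨x, ?_, rfl⟩, ⟨y, ?_, (LimitSpace.mk_eq_mk.2 hxy).symm⟩⟩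
    · change endWord x (endWord x d).length = _
      rw [length_endWord]
    · change endWord y (endWord y d).length = _
      rw [length_endWord]

/-- Some nucleus consists of restrictions in letters of its own elements. -/
theorem IsNucleus.exists_essential {G : Subgroup (treeAut X)} {N : Set (treeAut X)}
    (hN : IsNucleus G N) :
    ∃ N', IsNucleus G N' ∧ ∀ g ∈ N', ∃ h ∈ N', ∃ x : X, restrict h [x] = g := by
  let R : ℕ → Set (treeAut X) := fun k => {g | ∃ h ∈ N, ∃ v : List X, v.length = k ∧
    restrict h v = g}
  have hRN : ∀ k, R k ⊆ N := by
    rintro k _ ⟨h, hh, v, -, rfl⟩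
    exact hN.restrict_mem h hh v
  -- The sets `R k` decrease, so the first inclusion after one of minimal cardinality is an
  -- equality.
  obtain ⟨k, hk⟩ : ∃ k, ∀ l, (R k).ncard ≤ (R l).ncard := by
    obtain ⟨k, hk⟩ := Nat.sInf_mem (Set.range_nonempty fun k => (R k).ncard)
    exact ⟨k, fun l => hk.trans_le (Nat.sInf_le ⟨l, rfl⟩)⟩
  have hsub : R (k + 1) ⊆ R k := by
    rintro _ ⟨h, hh, v, hv, rfl⟩
    obtain ⟨x, w, rfl⟩ := List.exists_cons_of_length_eq_add_one hv
    exact ⟨restrict h [x], hN.restrict_mem h hh _, w, by simpa using hv, (restrict_cons h x w).symm⟩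
  have heq : R (k + 1) = R k :=
    Set.eq_of_subset_of_ncard_le hsub (hk _) (hN.finite.subset (hRN k))
  have hstep : ∀ g ∈ R k, ∀ x : X, restrict g [x] ∈ R k := by
    rintro _ ⟨h, hh, v, hv, rfl⟩ x
    rw [← heq]
    exact ⟨h, hh, v ++ [x], by simp [hv], restrict_append h v [x]⟩
  have hword : ∀ g ∈ R k, ∀ v : List X, restrict g v ∈ R k := by
    intro g hg v
    induction v generalizing g with
    | nil => rwa [restrict_nil]
    | cons x v ih =>
      rw [restrict_cons]
      exact ih _ (hstep g hg x)
  refine ⟨R k, ⟨hN.finite.subset (hRN k), (hRN k).trans hN.subset, hword, fun g hg => ?_⟩, ?_⟩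
  · obtain ⟨n, hn⟩ := hN.absorbing g hg
    refine ⟨n + k, fun v hv => ?_⟩
    rw [← List.take_append_drop (v.length - k) v, restrict_append]
    exact ⟨_, hn _ (by rw [List.length_take]; omega), _, by rw [List.length_drop]; omega, rfl⟩
  · intro g hg
    rw [← heq] at hg
    obtain ⟨h, hh, v, hv, rfl⟩ := hg
    obtain ⟨x, hx⟩ : ∃ x, v.drop k = [x] :=
      List.length_eq_one_iff.1 (by rw [List.length_drop, hv]; omega)
    refine ⟨restrict h (v.take k), ⟨h, hh, _, by rw [List.length_take]; omega, rfl⟩, x, ?_⟩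
    rw [← restrict_append, ← hx, List.take_append_drop]

theorem exists_endWord_eq_apply {g : ℕ → treeAut X} {x : ℕ → X}
    (h : ∀ k, restrict (g (k + 1)) [x k] = g k) :
    ∃ y : ℕ → X, ∀ k, (g k).1 (endWord x k) = endWord y k := by
  refine ⟨fun k => letterMap (g (k + 1)) (x k), fun k => ?_⟩
  induction k with
  | zero => exact apply_nil _
  | succ k ih => rw [endWord, apply_cons, h, ih]; rfl

/-- A finite set of automorphisms acts faithfully on some level. -/
theorem exists_level_of_finite {S : Set (treeAut X)} (hS : S.Finite) :
    ∃ d : ℕ, ∀ g ∈ S, g ≠ 1 → ∃ t : List X, t.length = d ∧ g.1 t ≠ t := by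
  have h : ∀ g : treeAut X, ∃ d : ℕ, g ≠ 1 → ∃ t : List X, t.length ≤ d ∧ g.1 t ≠ t := fun g => by
    by_cases hg : g = 1
    · exact ⟨0, fun h => absurd hg h⟩
    · obtain ⟨t, ht⟩ : ∃ t, g.1 t ≠ t := by
        by_contra! H
        exact hg (treeAut_ext H)
      exact ⟨t.length, fun _ => ⟨t, le_rfl, ht⟩⟩
  choose d hd using h
  obtain ⟨D, hD⟩ := (hS.image d).bddAbove
  refine ⟨D, fun g hg hg1 => ?_⟩
  obtain ⟨t, htl, ht⟩ := hd g hg1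
  by_contra! H
  exact ht (apply_eq_of_level_eq (h := 1) H (htl.trans (hD ⟨g, hg, rfl⟩)))

theorem ncard_support_le_of_essential [Finite X] {G : Subgroup (treeAut X)} {N : Set (treeAut X)}
    (hN : IsNucleus G N) (hess : ∀ g ∈ N, ∃ h ∈ N, ∃ x : X, restrict h [x] = g)
    (hT : ∀ u v : List X, u.length = v.length → u ≠ v → (tile G u ∩ tile G v).Finite)
    {h : treeAut X} (hh : h ∈ N) : ∃ C : ℕ, ∀ k, (support h k).ncard ≤ C := by
  obtain ⟨d, hd⟩ := exists_level_of_finite hN.finite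
  have hfin := finite_setOf_asympEquiv_ne hN hT d
  set S := {x | ∃ y, AsympEquiv G x y ∧ endWord x d ≠ endWord y d}
  choose p hp z hz using fun g : N => hess g.1 g.2
  let q : N → N := fun g => ⟨p g, hp g⟩
  -- A backward history of `h`: the element `a m`, restricted along the `m` letters `z (a (m-1)), …,
  -- z (a 0)`, gives `h`.
  let a : ℕ → N := fun i => q^[i] ⟨h, hh⟩
  have ha : ∀ i, restrict (a (i + 1)).1 [z (a i)] = (a i).1 := fun i => by
    have : a (i + 1) = q (a i) := Function.iterate_succ_apply' q i _
    rw [this]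
    exact hz (a i)
  have haw : ∀ m, restrict (a m).1 (endWord (fun i => z (a i)) m) = h := fun m => by
    induction m with
    | zero => exact restrict_nil _
    | succ m ih => rw [endWord, restrict_cons, ha, ih]
  refine ⟨S.ncard, fun k => ?_⟩
  refine (Set.ncard_le_ncard (t := (fun x => (endWord x (d + k)).take k) '' S) ?_
    (hfin.image _)).trans (Set.ncard_image_le hfin)
  rintro w ⟨hw, hw1⟩
  obtain ⟨t, ht, hne⟩ := hd _ (hN.restrict_mem h hh w) hw1
  -- The sequence `x` is the history of `h` followed by `w` and then by a word `t` of length `d`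
  -- moved by `h|_w`.
  obtain ⟨x, hx, hxz⟩ := exists_endWord_eq (w ++ t) fun i => z (a i)
  have hl : (w ++ t).length = d + k := by rw [List.length_append, hw, ht, Nat.add_comm]
  rw [hl] at hx hxz
  have hxz' : (fun i => x (d + k + i)) = fun i => z (a i) := funext hxz
  -- Reading `x` along the history, `g m` is the nucleus element that acts on the last `m` letters.
  -- In particular `g d = h|_w` acts on `t`, so the image sequence `y` differs from `x` in the last
  -- `d` letters.
  let g : ℕ → treeAut X := fun m => restrict (a m).1 (endWord (fun i => x (m + i)) (d + k))
  have hg : ∀ m, restrict (g (m + 1)) [x m] = g m := fun m => by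
    have h1 : endWord (fun i => x (m + 1 + i)) (d + k) ++ [x m] =
        z (a m) :: endWord (fun i => x (m + i)) (d + k) := by
      have h2 := endWord_add (fun i => x (m + i)) 1 (d + k)
      rw [Nat.add_comm 1 (d + k), endWord, Nat.add_comm m (d + k), hxz] at h2
      simp only [← Nat.add_assoc] at h2
      exact h2.symm
    rw [← restrict_append, h1, restrict_cons, ha]
  obtain ⟨y, hy⟩ := exists_endWord_eq_apply hg
  have hgN : ∀ m, g m ∈ N := fun m => hN.restrict_mem _ (a m).2 _
  have hsplit := endWord_add x d k
  rw [hx] at hsplit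
  obtain ⟨hw2, ht2⟩ := List.append_inj hsplit (by rw [hw, length_endWord])
  have hgd : g d = restrict h w := by
    have h1 := endWord_add (fun i => x (d + i)) k d
    simp only [← Nat.add_assoc, hxz', ← hw2] at h1
    change restrict (a d).1 (endWord (fun i => x (d + i)) (d + k)) = _
    rw [Nat.add_comm d k, h1, restrict_append, haw]
  refine ⟨x, ⟨y, asympEquiv_of_forall_exists_mem hN.finite hN.subset
    fun m => ⟨g m, hgN m, hy m⟩, ?_⟩, ?_⟩
  · rw [← hy d, hgd, ← ht2]
    exact hne.symm
  · change (endWord x (d + k)).take k = w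
    rw [hx, ← hw, List.take_left]

theorem subset_boundedAut_of_hasPCFLimitSpace [Finite X] {G : Subgroup (treeAut X)}
    (h : HasPCFLimitSpace G) : (G : Set (treeAut X)) ⊆ boundedAut X := by
  obtain ⟨hc, hT⟩ := h
  obtain ⟨N₀, hN₀⟩ := (isContracting_iff hc.1).1 hc
  obtain ⟨N, hN, hess⟩ := hN₀.exists_essential
  intro g hg
  obtain ⟨n, hn⟩ := hN.absorbing g hg
  have hlow : ((restrict g) '' {v : List X | v.length < n}).Finite :=
    (List.finite_length_lt X n).image _
  refine (mem_boundedAut_iff g).2 ⟨(hlow.union hN.finite).subset ?_, ?_⟩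
  · rintro _ ⟨v, rfl⟩
    rcases lt_or_ge v.length n with hv | hv
    · exact Or.inl ⟨v, hv, rfl⟩
    · exact Or.inr (hn v hv)
  · obtain ⟨C, hC⟩ := exists_ncard_biUnion_le (List.finite_length_eq X n)
      (fun v k => (v ++ ·) '' support (restrict g v) k) fun v hv => by
        obtain ⟨C, hC⟩ := ncard_support_le_of_essential hN hess hT (hn v (le_of_eq (Eq.symm hv)))
        exact ⟨C, fun k => (Set.ncard_image_le (finite_support _ k)).trans (hC k)⟩
    -- The first summand covers the levels below `n`; from level `n` on, `C` sums the bounds for the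
    -- restrictions on level `n`, which lie in the nucleus.
    refine ⟨{v : List X | v.length < n}.ncard + C, fun k => ?_⟩
    rcases lt_or_ge k n with hk | hk
    · exact (Set.ncard_le_ncard (fun v hv => hv.1.trans_lt hk)
        (List.finite_length_lt X n)).trans (Nat.le_add_right _ _)
    · obtain ⟨m, rfl⟩ := Nat.exists_eq_add_of_le hk
      refine ((Set.ncard_le_ncard ?_ ?_).trans (hC m)).trans (Nat.le_add_left _ _)
      · rintro v ⟨hv, hv1⟩
        rw [Set.mem_iUnion₂]
        refine ⟨v.take n, by simp [hv], v.drop n, ⟨by simp [hv], ?_⟩, List.take_append_drop n v⟩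
        rwa [← restrict_append, List.take_append_drop]
      · exact (List.finite_length_eq X n).biUnion fun v _ => (finite_support _ m).image _

end SelfSimilarGroup

theorem mainTheorem1 {X : Type*} [Finite X] :
    (∃ B : Subgroup (SelfSimilarGroup.treeAut X),
      (B : Set (SelfSimilarGroup.treeAut X)) = SelfSimilarGroup.boundedAut X) ∧
    (∀ G : Subgroup (SelfSimilarGroup.treeAut X), G.FG → SelfSimilarGroup.IsSelfSimilar G →
      (SelfSimilarGroup.HasPCFLimitSpace G ↔
        (G : Set (SelfSimilarGroup.treeAut X)) ⊆ SelfSimilarGroup.boundedAut X)) ∧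
    (∀ G : Subgroup (SelfSimilarGroup.treeAut X), G.FG → SelfSimilarGroup.IsSelfSimilar G →
      (G : Set (SelfSimilarGroup.treeAut X)) ⊆ SelfSimilarGroup.boundedAut X →
      SelfSimilarGroup.IsContracting G) := by
  refine ⟨⟨SelfSimilarGroup.boundedSubgroup X, rfl⟩, fun G hfg hG =>
    ⟨SelfSimilarGroup.subset_boundedAut_of_hasPCFLimitSpace, fun hB => ?_⟩, fun G hfg hG hB =>
    (SelfSimilarGroup.isContracting_iff hG).2
      (SelfSimilarGroup.exists_isNucleus_of_subset_boundedAut hfg hG hB)⟩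
  obtain ⟨N, hN⟩ := SelfSimilarGroup.exists_isNucleus_of_subset_boundedAut hfg hG hB
  exact ⟨(SelfSimilarGroup.isContracting_iff hG).2 ⟨N, hN⟩, fun u v huv hne =>
    SelfSimilarGroup.finite_tile_inter_tile hN hB huv hne⟩
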